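/- Let $n\ge 1$ and let $B$ be an $n\times n$ complex Hermitian matrix with eigenvalues $b_1\le b_2\le\dots\le b_n$, counted with multiplicity. Let $I\subseteq\mathbb{R}$ be an interval with more than one point and $[b_1,b_n]\subseteq I$, and let $f:I\to\mathbb{R}$ be differentiable at every $b_j$ (one-sidedly if $b_j$ is an endpoint of $I$). Put $\alpha=f'(b_1)$ and $\beta=f'(b_n)$, let $\phi=(1+\sqrt5)/2$ be the golden ratio, and let $L$ be the Loewner matrix of $f$ at $B$, $$ L_{ij}=\begin{cases}\dfrac{f(b_i)-f(b_j)}{b_i-b_j}, & b_i\ne b_j,\\[2mm] f'(b_i), & b_i=b_j,\end{cases}\qquad 1\le i,j\le n. $$ Let $\|S_L\|=\sup_{A\neq 0}\|L\circ A\|/\|A\|$ be its Schur multiplier norm, where the supremum is over the nonzero complex $n\times n$ matrices $A$, $(L\circ A)_{ij}=L_{ij}A_{ij}$, and $\|\cdot\|$ is the operator norm on $\mathbb{C}^n$ with the Euclidean norm. If $f$ is concave on $[b_1,b_n]$, then $$ \|S_L\|\le(\alpha-\beta)+\min\Big(|\beta|+\phi^{-1}\sum_{j=1}^n(\alpha-f'(b_j)),\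 |\alpha|+\phi^{-1}\sum_{j=1}^n(f'(b_j)-\beta)\Big). $$ If $f$ is convex on $[b_1,b_n]$, then $$ \|S_L\|\le(\beta-\alpha)+\min\Big(|\beta|+\phi^{-1}\sum_{j=1}^n(f'(b_j)-\alpha),\ |\alpha|+\phi^{-1}\sum_{j=1}^n(\beta-f'(b_j))\Big). $$ -/

import Mathlib

noncomputable section

namespace SchurLoewner

open scoped Matrix Matrix.Norms.L2Operator

/-- The Schur multiplier operator `S_L : A ↦ L ∘ A` (entrywise product) on complex matrices. -/
def schurMultiplier {n : ℕ} (L : Matrix (Fin n) (Fin n) ℂ) :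
    Matrix (Fin n) (Fin n) ℂ →ₗ[ℂ] Matrix (Fin n) (Fin n) ℂ where
  toFun A := L ⊙ A
  map_add' A B := Matrix.hadamard_add L A B
  map_smul' c A := Matrix.hadamard_smul L A c

/-- The Schur multiplier norm `‖S_L‖ = sup_A ‖L ∘ A‖ / ‖A‖`, where `‖A‖` is the operator norm of
`A` on the Euclidean space `ℂⁿ` (largest singular value). The zero matrix contributes the
value `0` to the supremum, which is harmless as all the ratios are nonnegative. -/
def schurNorm {n : ℕ} (L : Matrix (Fin n) (Fin n) ℂ) : ℝ :=
  ⨆ A : Matrix (Fin n) (Fin n) ℂ, ‖schurMultiplier L A‖ / ‖A‖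

/-- The supremum defining the Schur multiplier norm is that of a bounded set. -/
theorem bddAbove_schurNorm {n : ℕ} (L : Matrix (Fin n) (Fin n) ℂ) :
    BddAbove (Set.range fun A : Matrix (Fin n) (Fin n) ℂ => ‖schurMultiplier L A‖ / ‖A‖) := by
  refine ⟨‖LinearMap.toContinuousLinearMap (schurMultiplier L)‖, ?_⟩
  rintro _ ⟨A, rfl⟩
  exact div_le_of_le_mul₀ (norm_nonneg _) (norm_nonneg _)
    ((LinearMap.toContinuousLinearMap (schurMultiplier L)).le_opNorm A)

/-- The Loewner matrix at the points `b_1, …, b_n` of a real function `f` with domain `I`: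
divided differences where `b_i ≠ b_j`, and derivatives (relative to the domain `I`) where
`b_i = b_j`. -/
def loewnerMatrix (I : Set ℝ) (f : ℝ → ℝ) {n : ℕ} (b : Fin n → ℝ) :
    Matrix (Fin n) (Fin n) ℂ :=
  Matrix.of fun i j =>
    ((if b i = b j then derivWithin f I (b i) else (f (b i) - f (b j)) / (b i - b j) : ℝ) : ℂ)

/-- `b_1 ≤ … ≤ b_n` are the eigenvalues of `B`, with multiplicity, in non-decreasing order. -/
def IsSortedEigenvalues {n : ℕ} (B : Matrix (Fin n) (Fin n) ℂ) (b : Fin n → ℝ) : Prop :=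
  Monotone b ∧ B.charpoly = ∏ j, (Polynomial.X - Polynomial.C (b j : ℂ))

end SchurLoewner

end

noncomputable section

namespace SchurLoewner

open scoped Matrix Matrix.Norms.L2Operator
open Finset

/-! For concave `f` put `d j = f'(b j)`, an antitone sequence. A secant slope lies between the
derivatives at its ends, so each Loewner entry is a convex combination of `d i` and `d j`. Cutting
`d` into layers of height `t p = d p - d (p+1)` writes `L` as the constant `β` plus `∑ t p * N p`,
where `N p` has entries in `[0,1]`, is `1` on the block of the indices `≤ p` and `0` on the
complementary block (`schurNorm_le_of_mem_uIcc`).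

By `norm_hadamard_le_of_block`, `N p` has Schur norm at most `1 + φ⁻¹ q`, with `q` the number of
indices `> p`. Summing over layers gives `α - β` and, by double counting, `φ⁻¹ ∑ (α - d j)`.
Expanding down from `α` with `1 - N p` gives the other bound; convex `f` reduces to `-f`. -/

/-! ### Operator norm and sums of squares. -/

theorem sum_sq_norm_mulVec_le {ι : Type*} [Fintype ι] [DecidableEq ι]
    (A : Matrix ι ι ℂ) (x : ι → ℂ) :
    ∑ i, ‖∑ j, A i j * x j‖ ^ 2 ≤ ‖A‖ ^ 2 * ∑ j, ‖x j‖ ^ 2 := by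
  have h := A.l2_opNorm_mulVec (WithLp.toLp 2 x)
  have h2 := pow_le_pow_left₀ (norm_nonneg _) h 2
  rw [mul_pow, EuclideanSpace.norm_sq_eq, EuclideanSpace.norm_sq_eq] at h2
  exact h2

theorem l2_opNorm_le_of_sum_sq_le {ι : Type*} [Fintype ι] [DecidableEq ι]
    {A : Matrix ι ι ℂ} {C : ℝ} (hC : 0 ≤ C)
    (h : ∀ x : ι → ℂ, ∑ i, ‖∑ j, A i j * x j‖ ^ 2 ≤ C ^ 2 * ∑ j, ‖x j‖ ^ 2) : ‖A‖ ≤ C := by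
  rw [Matrix.cstar_norm_def]
  refine ContinuousLinearMap.opNorm_le_bound _ hC fun x => ?_
  refine le_of_sq_le_sq ?_ (by positivity)
  rw [mul_pow, EuclideanSpace.norm_sq_eq, EuclideanSpace.norm_sq_eq]
  exact h x

theorem sum_sq_norm_col_le {ι : Type*} [Fintype ι] [DecidableEq ι]
    (A : Matrix ι ι ℂ) (j : ι) : ∑ i, ‖A i j‖ ^ 2 ≤ ‖A‖ ^ 2 := by
  have h := sum_sq_norm_mulVec_le A (Pi.single j 1)
  have h1 : ∀ i, ∑ k, A i k * (Pi.single j 1 : ι → ℂ) k = A i j := fun i => by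
    simp [Pi.single_apply]
  have h2 : ∑ k, ‖(Pi.single j 1 : ι → ℂ) k‖ ^ 2 = 1 := by
    rw [Finset.sum_eq_single j] <;> simp +contextual
  simpa only [h1, h2, mul_one] using h

theorem sum_sq_norm_row_le {ι : Type*} [Fintype ι] [DecidableEq ι]
    (A : Matrix ι ι ℂ) (i : ι) : ∑ j, ‖A i j‖ ^ 2 ≤ ‖A‖ ^ 2 := by
  have h := sum_sq_norm_col_le Aᴴ i
  rw [Matrix.l2_opNorm_conjTranspose] at h
  simpa only [Matrix.conjTranspose_apply, norm_star] using h

/-- Cauchy–Schwarz, with the multiplier entries `u` bounded away; it controls the off-diagonal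
blocks, where the multiplier is unknown. -/
theorem sq_norm_sum_mul_le {ι : Type*} (T : Finset ι) (u v x : ι → ℂ)
    (hu : ∀ j, ‖u j‖ ≤ 1) :
    ‖∑ j ∈ T, u j * v j * x j‖ ^ 2 ≤ (∑ j ∈ T, ‖v j‖ ^ 2) * ∑ j ∈ T, ‖x j‖ ^ 2 := by
  refine le_trans (pow_le_pow_left₀ (norm_nonneg _) ?_ 2)
    (Finset.sum_mul_sq_le_sq_mul_sq T (fun j => ‖v j‖) (fun j => ‖x j‖))
  refine (norm_sum_le _ _).trans (Finset.sum_le_sum fun j _ => ?_)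
  rw [norm_mul, norm_mul]
  have := mul_le_mul_of_nonneg_right (hu j) (norm_nonneg (v j))
  exact mul_le_mul_of_nonneg_right (by linarith) (norm_nonneg _)

theorem sq_norm_add_le_weighted {s : ℝ} (hs : 0 < s) (u v : ℂ) :
    ‖u + v‖ ^ 2 ≤ (1 + s) * ‖u‖ ^ 2 + (1 + s⁻¹) * ‖v‖ ^ 2 := by
  have h1 := pow_le_pow_left₀ (norm_nonneg _) (norm_add_le u v) 2
  have h2 : 0 ≤ s⁻¹ * (s * ‖u‖ - ‖v‖) ^ 2 := by positivity
  have h3 : s⁻¹ * (s * ‖u‖ - ‖v‖) ^ 2 = s * ‖u‖ ^ 2 - 2 * (‖u‖ * ‖v‖) + s⁻¹ * ‖v‖ ^ 2 := by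
    field_simp
    ring
  nlinarith

/-! ### Block multipliers and the golden ratio. -/

theorem inv_goldenRatio_pos : 0 < Real.goldenRatio⁻¹ := inv_pos.2 Real.goldenRatio_pos

theorem inv_goldenRatio_sq : Real.goldenRatio⁻¹ ^ 2 = 1 - Real.goldenRatio⁻¹ := by
  rw [Real.inv_goldenRatio, neg_sq, Real.goldenConj_sq]
  ring

/-- A Schur multiplier with entries in the unit disc which is `1` on `S × S` and `0` on
`Sᶜ × Sᶜ` has norm at most `1 + φ⁻¹ |Sᶜ|`. -/
theorem norm_hadamard_le_of_block {ι : Type*} [Fintype ι] [DecidableEq ι]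
    (S : Finset ι) (N A : Matrix ι ι ℂ) (hN : ∀ i j, ‖N i j‖ ≤ 1)
    (h1 : ∀ i ∈ S, ∀ j ∈ S, N i j = 1) (h0 : ∀ i ∈ Sᶜ, ∀ j ∈ Sᶜ, N i j = 0) :
    ‖N ⊙ A‖ ≤ (1 + Real.goldenRatio⁻¹ * (#Sᶜ : ℝ)) * ‖A‖ := by
  rcases Finset.eq_empty_or_nonempty Sᶜ with hS | hS
  · have hS' : S = univ := by simpa using hS
    have : N ⊙ A = A := by
      ext i j
      simp [h1 i (by simp [hS']) j (by simp [hS'])]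
    simp [this, hS]
  set g := Real.goldenRatio⁻¹ with hg
  set q : ℝ := (#Sᶜ : ℝ) with hq
  have hg0 : 0 < g := inv_goldenRatio_pos
  have hg2 : g ^ 2 = 1 - g := inv_goldenRatio_sq
  have hq1 : 1 ≤ q := by
    rw [hq]
    exact_mod_cast hS.card_pos
  -- The weight `g * q` for splitting `‖u + v‖ ^ 2` makes both final coefficients at most `(1 + g *
  -- q) ^ 2`.
  have hs : 0 < g * q := by positivity
  refine l2_opNorm_le_of_sum_sq_le (by positivity) fun x => ?_
  set M := ‖A‖
  set a := ∑ j ∈ S, ‖x j‖ ^ 2 with ha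
  set b := ∑ j ∈ Sᶜ, ‖x j‖ ^ 2 with hb
  have ha0 : 0 ≤ a := by positivity
  have hb0 : 0 ≤ b := by positivity
  have hu : ∑ i ∈ S, ‖∑ j ∈ S, A i j * x j‖ ^ 2 ≤ M ^ 2 * a := by
    have h := sum_sq_norm_mulVec_le A (fun j => if j ∈ S then x j else 0)
    have e1 : ∀ i, ∑ j, A i j * (if j ∈ S then x j else 0) = ∑ j ∈ S, A i j * x j := fun i => by
      simp [Finset.sum_ite_mem, mul_ite]
    have e2 : ∑ j, ‖(if j ∈ S then x j else 0)‖ ^ 2 = a := by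
      simp [ha, apply_ite, Finset.sum_ite_mem]
    simp only [e1] at h
    rw [e2] at h
    exact (Finset.sum_le_sum_of_subset_of_nonneg (subset_univ S)
      fun _ _ _ => by positivity).trans h
  -- Hilbert–Schmidt bound: the block has `q` columns, each of norm at most `M`.
  have hv : ∑ i ∈ S, ‖∑ j ∈ Sᶜ, N i j * A i j * x j‖ ^ 2 ≤ q * M ^ 2 * b := by
    calc ∑ i ∈ S, ‖∑ j ∈ Sᶜ, N i j * A i j * x j‖ ^ 2
        ≤ ∑ i ∈ S, (∑ j ∈ Sᶜ, ‖A i j‖ ^ 2) * b :=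
          Finset.sum_le_sum fun i _ => sq_norm_sum_mul_le _ _ _ _ (hN i)
      _ = (∑ j ∈ Sᶜ, ∑ i ∈ S, ‖A i j‖ ^ 2) * b := by
          rw [← Finset.sum_mul, Finset.sum_comm]
      _ ≤ (∑ j ∈ Sᶜ, M ^ 2) * b := by
          refine mul_le_mul_of_nonneg_right (Finset.sum_le_sum fun j _ => ?_) hb0
          exact (Finset.sum_le_sum_of_subset_of_nonneg (subset_univ S)
            fun _ _ _ => by positivity).trans (sum_sq_norm_col_le A j)
      _ = q * M ^ 2 * b := by rw [Finset.sum_const, nsmul_eq_mul]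
  have hw : ∑ i ∈ Sᶜ, ‖∑ j ∈ S, N i j * A i j * x j‖ ^ 2 ≤ q * (M ^ 2 * a) := by
    calc ∑ i ∈ Sᶜ, ‖∑ j ∈ S, N i j * A i j * x j‖ ^ 2
        ≤ ∑ i ∈ Sᶜ, M ^ 2 * a := by
          refine Finset.sum_le_sum fun i _ => (sq_norm_sum_mul_le _ _ _ _ (hN i)).trans ?_
          refine mul_le_mul_of_nonneg_right ?_ ha0
          exact (Finset.sum_le_sum_of_subset_of_nonneg (subset_univ S)
            fun _ _ _ => by positivity).trans (sum_sq_norm_row_le A i)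
      _ = q * (M ^ 2 * a) := by rw [Finset.sum_const, nsmul_eq_mul]
  have hyS : ∑ i ∈ S, ‖∑ j, (N ⊙ A) i j * x j‖ ^ 2
      ≤ (1 + g * q) * (M ^ 2 * a) + (1 + (g * q)⁻¹) * (q * M ^ 2 * b) := by
    calc ∑ i ∈ S, ‖∑ j, (N ⊙ A) i j * x j‖ ^ 2
        ≤ ∑ i ∈ S, ((1 + g * q) * ‖∑ j ∈ S, A i j * x j‖ ^ 2
            + (1 + (g * q)⁻¹) * ‖∑ j ∈ Sᶜ, N i j * A i j * x j‖ ^ 2) := by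
          refine Finset.sum_le_sum fun i hi => ?_
          have e : ∑ j, (N ⊙ A) i j * x j
              = ∑ j ∈ S, A i j * x j + ∑ j ∈ Sᶜ, N i j * A i j * x j := by
            rw [← Finset.sum_add_sum_compl S]
            congr 1
            exact Finset.sum_congr rfl fun j hj => by simp [h1 i hi j hj]
          rw [e]
          exact sq_norm_add_le_weighted hs _ _
      _ ≤ _ := by
          rw [Finset.sum_add_distrib, ← Finset.mul_sum, ← Finset.mul_sum]
          gcongr
  have hyT : ∑ i ∈ Sᶜ, ‖∑ j, (N ⊙ A) i j * x j‖ ^ 2 ≤ q * (M ^ 2 * a) := by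
    refine le_of_eq_of_le (Finset.sum_congr rfl fun i hi => ?_) hw
    rw [← Finset.sum_add_sum_compl S, Finset.sum_eq_zero (s := Sᶜ), add_zero]
    · rfl
    · exact fun j hj => by simp [h0 i hi j hj]
  have hginv : g⁻¹ = 1 + g := by
    field_simp
    nlinarith
  have hqinv : (1 + (g * q)⁻¹) * q = q + (1 + g) := by
    rw [← hginv]
    field_simp
  -- Equality holds at `q = 1`, by `g ^ 2 = 1 - g`; this is where the golden ratio comes from.
  have hE : (1 + g * q) ^ 2 ≥ 1 + g * q + q := by
    have h : (1 + g * q) ^ 2 - (1 + g * q + q) = g ^ 2 * q * (q - 1) := by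
      linear_combination q * hg2
    have : 0 ≤ g ^ 2 * q * (q - 1) := mul_nonneg (by positivity) (by linarith)
    linarith
  have hE2 : (1 + g * q) ^ 2 ≥ q + (1 + g) := by nlinarith
  rw [← Finset.sum_add_sum_compl S, ← Finset.sum_add_sum_compl S (fun j => ‖x j‖ ^ 2)]
  have k1 := mul_le_mul_of_nonneg_right hE (mul_nonneg (sq_nonneg M) ha0)
  have k2 := mul_le_mul_of_nonneg_right hE2 (mul_nonneg (sq_nonneg M) hb0)
  have k3 : (1 + (g * q)⁻¹) * (q * M ^ 2 * b) = (q + (1 + g)) * (M ^ 2 * b) := by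
    rw [← hqinv]
    ring
  rw [k3] at hyS
  calc _ ≤ _ := add_le_add hyS hyT
    _ = (1 + g * q + q) * (M ^ 2 * a) + (q + (1 + g)) * (M ^ 2 * b) := by ring
    _ ≤ (1 + g * q) ^ 2 * (M ^ 2 * a) + (1 + g * q) ^ 2 * (M ^ 2 * b) := add_le_add k1 k2
    _ = ((1 + g * q) * M) ^ 2 * (a + b) := by ring

/-! ### Decomposition into layers. -/

theorem schurNorm_le {n : ℕ} {L : Matrix (Fin n) (Fin n) ℂ} {C : ℝ} (hC : 0 ≤ C)
    (h : ∀ A : Matrix (Fin n) (Fin n) ℂ, ‖L ⊙ A‖ ≤ C * ‖A‖) : schurNorm L ≤ C :=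
  ciSup_le fun A => div_le_of_le_mul₀ (norm_nonneg _) hC (h A)

theorem schurNorm_neg {n : ℕ} (L : Matrix (Fin n) (Fin n) ℂ) :
    schurNorm (-L) = schurNorm L := by
  have h : ∀ A, schurMultiplier (-L) A = -schurMultiplier L A := fun A => by
    ext i j
    simp [schurMultiplier]
  simp only [schurNorm, h, norm_neg]

theorem sum_range_sub_mul_ite (D : ℕ → ℝ) {j m : ℕ} (h : j ≤ m) :
    ∑ p ∈ range m, (D p - D (p + 1)) * (if j ≤ p then 1 else 0) = D j - D m := by
  induction m, h using Nat.le_induction with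
  | base =>
    rw [sub_self]
    exact Finset.sum_eq_zero fun p hp => by simp [not_le.2 (mem_range.1 hp)]
  | succ k hk ih =>
    rw [Finset.sum_range_succ, ih, if_pos hk]
    ring

/-- The bound for a multiplier which is a constant plus a nonnegative combination of
block multipliers. -/
theorem schurNorm_le_of_layers {n m : ℕ} {L : Matrix (Fin n) (Fin n) ℂ} (c : ℝ) (t : ℕ → ℝ)
    (ht : ∀ p, 0 ≤ t p) (ε : ℝ) (hε : |ε| = 1) (S : ℕ → Finset (Fin n))
    (N : ℕ → Matrix (Fin n) (Fin n) ℝ)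
    (hN0 : ∀ p i j, 0 ≤ N p i j) (hN1 : ∀ p i j, N p i j ≤ 1)
    (h1 : ∀ p, ∀ i ∈ S p, ∀ j ∈ S p, N p i j = 1)
    (h0 : ∀ p, ∀ i ∈ (S p)ᶜ, ∀ j ∈ (S p)ᶜ, N p i j = 0)
    (hL : ∀ i j, L i j = ((c + ε * ∑ p ∈ range m, t p * N p i j : ℝ) : ℂ)) :
    schurNorm L ≤ |c| + (∑ p ∈ range m, t p
      + Real.goldenRatio⁻¹ * ∑ p ∈ range m, t p * #(S p)ᶜ) := by
  have hg := inv_goldenRatio_pos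
  have hC : |c| + (∑ p ∈ range m, t p + Real.goldenRatio⁻¹ * ∑ p ∈ range m, t p * #(S p)ᶜ)
      = |c| + ∑ p ∈ range m, t p * (1 + Real.goldenRatio⁻¹ * (#(S p)ᶜ : ℝ)) := by
    rw [Finset.mul_sum, ← Finset.sum_add_distrib]
    congr 1
    exact Finset.sum_congr rfl fun p _ => by ring
  rw [hC]
  refine schurNorm_le (add_nonneg (abs_nonneg c) (Finset.sum_nonneg fun p _ =>
    mul_nonneg (ht p) (by positivity))) fun A => ?_
  have e : L ⊙ A = (c : ℂ) • A
      + (ε : ℂ) • ∑ p ∈ range m, (t p : ℂ) • ((N p).map Complex.ofReal ⊙ A) := by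
    ext i j
    simp only [Matrix.hadamard_apply, hL, Matrix.add_apply, Matrix.smul_apply, Matrix.sum_apply,
      Matrix.map_apply, smul_eq_mul]
    push_cast
    rw [add_mul, mul_assoc, Finset.sum_mul]
    simp only [mul_assoc]
  rw [e, add_mul, Finset.sum_mul]
  refine (norm_add_le _ _).trans (add_le_add ?_ ?_)
  · rw [norm_smul, Complex.norm_real, Real.norm_eq_abs]
  · rw [norm_smul, Complex.norm_real, Real.norm_eq_abs, hε, one_mul]
    refine (norm_sum_le _ _).trans (Finset.sum_le_sum fun p _ => ?_)
    rw [norm_smul, Complex.norm_real, Real.norm_eq_abs, abs_of_nonneg (ht p), mul_assoc]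
    refine mul_le_mul_of_nonneg_left (norm_hadamard_le_of_block (S p) _ A ?_ ?_ ?_) (ht p)
    · intro i j
      rw [Matrix.map_apply, Complex.norm_real, Real.norm_eq_abs, abs_of_nonneg (hN0 p i j)]
      exact hN1 p i j
    · exact fun i hi j hj => by simp [h1 p i hi j hj]
    · exact fun i hi j hj => by simp [h0 p i hi j hj]

/-- A real matrix whose `(i, j)` entry lies between the terms `D i` and `D j` of an antitone
sequence. -/
theorem schurNorm_le_of_mem_uIcc {m : ℕ} (D : ℕ → ℝ) (hD : Antitone D)
    (K : Fin (m + 1) → Fin (m + 1) → ℝ)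
    (hK : ∀ i j : Fin (m + 1), K i j ∈ Set.uIcc (D i) (D j)) :
    schurNorm (Matrix.of fun i j => (K i j : ℂ)) ≤ (D 0 - D m) + min
      (|D m| + Real.goldenRatio⁻¹ * ∑ j : Fin (m + 1), (D 0 - D j))
      (|D 0| + Real.goldenRatio⁻¹ * ∑ j : Fin (m + 1), (D j - D m)) := by
  have hθ : ∀ i j : Fin (m + 1), ∃ θ : ℝ, 0 ≤ θ ∧ θ ≤ 1 ∧ K i j = (1 - θ) * D i + θ * D j := fun i j => by
    have h := hK i j
    rw [← segment_eq_uIcc, segment_eq_image] at h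
    obtain ⟨θ, hθ, h⟩ := h
    exact ⟨θ, hθ.1, hθ.2, by simpa using h.symm⟩
  choose θ hθ0 hθ1 hθK using hθ
  set t : ℕ → ℝ := fun p => D p - D (p + 1) with ht_def
  have ht : ∀ p, 0 ≤ t p := fun p => sub_nonneg.2 (hD p.le_succ)
  have htsum : ∑ p ∈ range m, t p = D 0 - D m := Finset.sum_range_sub' D m
  set e : ℕ → Fin (m + 1) → ℝ := fun p j => if (j : ℕ) ≤ p then 1 else 0 with he
  have he0 : ∀ p j, 0 ≤ e p j := fun p j => by simp only [he]; split_ifs <;> norm_num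
  have he1 : ∀ p j, e p j ≤ 1 := fun p j => by simp only [he]; split_ifs <;> norm_num
  have hesum : ∀ j, ∑ p ∈ range m, t p * e p j = D j - D m := fun j =>
    sum_range_sub_mul_ite D (Nat.lt_succ_iff.1 j.2)
  -- The same `θ i j` serves every layer, so the layers sum back to `K i j - D m`.
  set N : ℕ → Matrix (Fin (m + 1)) (Fin (m + 1)) ℝ :=
    fun p i j => (1 - θ i j) * e p i + θ i j * e p j with hN
  have hNsum : ∀ i j, ∑ p ∈ range m, t p * N p i j = K i j - D m := fun i j => by
    calc ∑ p ∈ range m, t p * N p i j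
        = (1 - θ i j) * ∑ p ∈ range m, t p * e p i + θ i j * ∑ p ∈ range m, t p * e p j := by
          rw [Finset.mul_sum, Finset.mul_sum, ← Finset.sum_add_distrib]
          exact Finset.sum_congr rfl fun p _ => by simp only [hN]; ring
      _ = K i j - D m := by rw [hesum, hesum, hθK]; ring
  have hN0 : ∀ p i j, 0 ≤ N p i j := fun p i j =>
    add_nonneg (mul_nonneg (by linarith [hθ1 i j]) (he0 p i)) (mul_nonneg (hθ0 i j) (he0 p j))
  have hN1 : ∀ p i j, N p i j ≤ 1 := fun p i j => by
    have k1 := mul_le_mul_of_nonneg_left (he1 p i) (sub_nonneg.2 (hθ1 i j))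
    have k2 := mul_le_mul_of_nonneg_left (he1 p j) (hθ0 i j)
    simp only [hN]
    linarith
  set S : ℕ → Finset (Fin (m + 1)) := fun p => univ.filter fun j => (j : ℕ) ≤ p with hS
  have hNS : ∀ p, ∀ i ∈ S p, ∀ j ∈ S p, N p i j = 1 := fun p i hi j hj => by
    simp only [hS, mem_filter, mem_univ, true_and] at hi hj
    simp [hN, he, hi, hj]
  have hNSc : ∀ p, ∀ i ∈ (S p)ᶜ, ∀ j ∈ (S p)ᶜ, N p i j = 0 := fun p i hi j hj => by
    simp only [hS, mem_compl, mem_filter, mem_univ, true_and] at hi hj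
    simp [hN, he, hi, hj]
  have hcard : ∀ p, (#(S p) : ℝ) = ∑ j, e p j := fun p => by
    simp [hS, he]
  have hcardc : ∀ p, (#(S p)ᶜ : ℝ) = ∑ j, (1 - e p j) := fun p => by
    rw [Finset.sum_sub_distrib, ← hcard, Finset.card_compl,
      Nat.cast_sub (Finset.card_le_univ _)]
    simp
  have hsum1 : ∑ p ∈ range m, t p * #(S p)ᶜ = ∑ j : Fin (m + 1), (D 0 - D j) := by
    simp only [hcardc, Finset.mul_sum]
    rw [Finset.sum_comm]
    refine Finset.sum_congr rfl fun j _ => ?_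
    simp only [mul_sub, mul_one, Finset.sum_sub_distrib]
    rw [htsum, hesum]
    ring
  have hsum2 : ∑ p ∈ range m, t p * #(S p)ᶜᶜ = ∑ j : Fin (m + 1), (D j - D m) := by
    simp only [compl_compl, hcard, Finset.mul_sum]
    rw [Finset.sum_comm]
    exact Finset.sum_congr rfl fun j _ => hesum j
  rw [← min_add_add_left]
  refine le_min ?_ ?_
  · have h := schurNorm_le_of_layers (m := m) (L := Matrix.of fun i j => (K i j : ℂ))
      (D m) t ht 1 (by simp) S N hN0 hN1 hNS hNSc fun i j => by
        rw [hNsum, Matrix.of_apply]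
        congr 1
        ring
    rw [hsum1, htsum] at h
    linarith
  -- Subtracting from the top value exchanges the roles of `S p` and its complement.
  · have h := schurNorm_le_of_layers (m := m) (L := Matrix.of fun i j => (K i j : ℂ))
      (D 0) t ht (-1) (by simp) (fun p => (S p)ᶜ) (fun p i j => 1 - N p i j)
      (fun p i j => sub_nonneg.2 (hN1 p i j)) (fun p i j => by linarith [hN0 p i j])
      (fun p i hi j hj => by rw [hNSc p i hi j hj, sub_zero])
      (fun p i hi j hj => by
        rw [compl_compl] at hi hj
        rw [hNS p i hi j hj, sub_self])
      fun i j => by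
        simp only [mul_sub, mul_one, Finset.sum_sub_distrib]
        rw [hNsum, htsum, Matrix.of_apply]
        congr 1
        ring
    rw [hsum2, htsum] at h
    linarith

/-! ### Loewner matrices of concave and convex functions. -/

theorem schurNorm_loewnerMatrix_le_of_concaveOn {m : ℕ} (b : Fin (m + 1) → ℝ) (hb : Monotone b)
    (I : Set ℝ) (hbI : Set.Icc (b 0) (b (Fin.last m)) ⊆ I) (f : ℝ → ℝ)
    (hf : ∀ j, DifferentiableWithinAt ℝ f I (b j))
    (hconc : ConcaveOn ℝ (Set.Icc (b 0) (b (Fin.last m))) f) :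
    schurNorm (loewnerMatrix I f b) ≤
      (derivWithin f I (b 0) - derivWithin f I (b (Fin.last m))) + min
        (|derivWithin f I (b (Fin.last m))| + Real.goldenRatio⁻¹ *
          ∑ j, (derivWithin f I (b 0) - derivWithin f I (b j)))
        (|derivWithin f I (b 0)| + Real.goldenRatio⁻¹ *
          ∑ j, (derivWithin f I (b j) - derivWithin f I (b (Fin.last m)))) := by
  set d : Fin (m + 1) → ℝ := fun j => derivWithin f I (b j) with hd
  have hmem : ∀ j, b j ∈ Set.Icc (b 0) (b (Fin.last m)) := fun j =>
    ⟨hb (Fin.zero_le j), hb (Fin.le_last j)⟩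
  have hder : ∀ j, HasDerivWithinAt f (d j) (Set.Icc (b 0) (b (Fin.last m))) (b j) := fun j =>
    (hf j).hasDerivWithinAt.mono hbI
  have hupper : ∀ i j, b i < b j → slope f (b i) (b j) ≤ d i := fun i j h =>
    hconc.slope_le_of_hasDerivWithinAt (hmem i) (hmem j) h (hder i)
  have hlower : ∀ i j, b i < b j → d j ≤ slope f (b i) (b j) := fun i j h =>
    hconc.le_slope_of_hasDerivWithinAt (hmem i) (hmem j) h (hder j)
  have hanti : Antitone d := fun i j hij => by
    rcases (hb hij).eq_or_lt with h | h
    · simp only [hd, h, le_refl]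
    · exact (hlower i j h).trans (hupper i j h)
  -- Continuing `d` by its last value keeps it antitone on all of `ℕ`.
  set D : ℕ → ℝ := fun k => d ⟨min k m, by omega⟩ with hD
  have hDanti : Antitone D := fun k l hkl => hanti (Fin.mk_le_mk.2 (min_le_min_right m hkl))
  have hDj : ∀ j : Fin (m + 1), D j = d j := fun j => by
    simp only [hD, min_eq_left (Nat.lt_succ_iff.1 j.2)]
  have hD0 : D 0 = d 0 := hDj 0
  have hDm : D m = d (Fin.last m) := hDj (Fin.last m)
  have h := schurNorm_le_of_mem_uIcc D hDanti
    (fun i j => if b i = b j then derivWithin f I (b i) else (f (b i) - f (b j)) / (b i - b j))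
    fun i j => by
      rw [hDj, hDj]
      split_ifs with hij
      · exact Set.left_mem_uIcc
      · rw [← slope_def_field, slope_comm]
        rcases lt_or_gt_of_ne hij with hlt | hgt
        · exact Set.mem_uIcc_of_ge (hlower i j hlt) (hupper i j hlt)
        · rw [slope_comm]
          exact Set.mem_uIcc_of_le (hlower j i hgt) (hupper j i hgt)
  simp only [hDj, hD0, hDm] at h
  exact h

theorem loewnerMatrix_neg {n : ℕ} (I : Set ℝ) (f : ℝ → ℝ) (b : Fin n → ℝ) :
    loewnerMatrix I (-f) b = -loewnerMatrix I f b := by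
  ext i j
  rw [Matrix.neg_apply, loewnerMatrix, loewnerMatrix, Matrix.of_apply, Matrix.of_apply,
    ← Complex.ofReal_neg]
  congr 1
  split_ifs
  · exact derivWithin.neg
  · simp only [Pi.neg_apply]
    ring

end SchurLoewner

end

theorem mainTheorem1 (n : ℕ) (hn : 0 < n)
    (B : Matrix (Fin n) (Fin n) ℂ) (hB : B.IsHermitian)
    (b : Fin n → ℝ) (hb : SchurLoewner.IsSortedEigenvalues B b)
    (b₁ bₙ : ℝ) (hb₁ : b₁ = b ⟨0, hn⟩) (hbₙ : bₙ = b ⟨n - 1, Nat.sub_one_lt_of_lt hn⟩)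
    (I : Set ℝ) (hI : I.OrdConnected) (hI' : I.Nontrivial) (hbI : Set.Icc b₁ bₙ ⊆ I)
    (f : ℝ → ℝ) (hf : ∀ j, DifferentiableWithinAt ℝ f I (b j))
    (α β : ℝ) (hα : α = derivWithin f I b₁) (hβ : β = derivWithin f I bₙ) :
    (ConcaveOn ℝ (Set.Icc b₁ bₙ) f →
      SchurLoewner.schurNorm (SchurLoewner.loewnerMatrix I f b) ≤
        (α - β) + min
          (|β| + Real.goldenRatio⁻¹ * ∑ j, (α - derivWithin f I (b j)))
          (|α| + Real.goldenRatio⁻¹ * ∑ j, (derivWithin f I (b j) - β))) ∧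
    (ConvexOn ℝ (Set.Icc b₁ bₙ) f →
      SchurLoewner.schurNorm (SchurLoewner.loewnerMatrix I f b) ≤
        (β - α) + min
          (|β| + Real.goldenRatio⁻¹ * ∑ j, (derivWithin f I (b j) - α))
          (|α| + Real.goldenRatio⁻¹ * ∑ j, (β - derivWithin f I (b j)))) := by
  obtain ⟨m, rfl⟩ : ∃ m, n = m + 1 := ⟨n - 1, by omega⟩
  have e0 : b₁ = b 0 := hb₁
  have e1 : bₙ = b (Fin.last m) := hbₙ
  subst e0 e1 hα hβ
  refine ⟨SchurLoewner.schurNorm_loewnerMatrix_le_of_concaveOn b hb.1 I hbI f hf, fun hconv => ?_⟩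
  have h := SchurLoewner.schurNorm_loewnerMatrix_le_of_concaveOn b hb.1 I hbI (-f)
    (fun j => (hf j).neg) hconv.neg
  rw [SchurLoewner.loewnerMatrix_neg, SchurLoewner.schurNorm_neg] at h
  simpa only [derivWithin.neg, abs_neg, neg_sub_neg] using h
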